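/- Let $d\ge 3$ be an integer, $0<\lambda<1$, $s=(d-3)+2\lambda$ and $R>0$, and let $$\mathbb D_R=\{x\in\mathbb R^d:\ x_1=0,\ x_2^2+\dots+x_d^2\le R^2\}.$$ For a Borel probability measure $\mu$ on $\mathbb R^d$ supported on $\mathbb D_R$ let $I_s(\mu)=\iint |x-y|^{-s}\,d\mu(x)\,d\mu(y)\in[0,\infty]$ (the kernel being $+\infty$ for $x=y$), let $W_s(\mathbb D_R)$ be the infimum of $I_s(\mu)$ over all such $\mu$, and let $\operatorname{cap}_s(\mathbb D_R)=1/W_s(\mathbb D_R)$. Then there is exactly one such measure $\mu$ with $I_s(\mu)=W_s(\mathbb D_R)$, the Riesz $s$-equilibrium measure $\mu_{\mathbb D_R}$, and it is given by $$d\mu_{\mathbb D_R}(x)=f(r)\,r^{d-2}\,dr\,d\sigma_{d-1}(\overline x),\qquad x=(0,r\overline x),\quad \overline x\in\mathbb S^{d-2},\quad 0\le r\le R,$$ where $\sigma_{d-1}$ is the surface area measure of the unit sphere $\mathbb S^{d-2}$ of $\mathbb R^{d-1}$ and $$f(r)=\frac{\Gamma((d+2\lambda-1)/2)}{\pi^{(d-1)/2}\,\Gamma(\lambda)}\,\frac1{R^{d+2\lambda-3}}\,(R^2-r^2)^{\lambda-1}.$$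 Moreover $$\operatorname{cap}_s(\mathbb D_R)=\frac{\sin(\lambda\pi)\,\Gamma(\lambda)\,\Gamma((d-1)/2)}{\pi\,\Gamma((d+2\lambda-1)/2)}\,R^{d+2\lambda-3}.$$ -/

import Mathlib

open MeasureTheory

namespace RieszDisk

noncomputable section

/-- The Riesz kernel `1 / |x - y| ^ s`, with values in `[0, ∞]`. For `0 < s` it equals `∞` on the
diagonal. -/
def rieszKernel {m : ℕ} (s : ℝ) (x y : EuclideanSpace ℝ (Fin m)) : ENNReal :=
  1 / edist x y ^ s

/-- The Riesz `s`-energy `I_s(μ) = ∬ 1 / |x - y| ^ s dμ(x) dμ(y)`. -/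
def rieszEnergy {m : ℕ} (s : ℝ) (μ : Measure (EuclideanSpace ℝ (Fin m))) : ENNReal :=
  ∫⁻ x, ∫⁻ y, rieszKernel s x y ∂μ ∂μ

/-- The class `M(E)` of Borel probability measures on `ℝ^m` supported on the closed set `E`. -/
def unitMeasures {m : ℕ} (E : Set (EuclideanSpace ℝ (Fin m))) :
    Set (Measure (EuclideanSpace ℝ (Fin m))) :=
  {μ | IsProbabilityMeasure μ ∧ μ Eᶜ = 0}

/-- The minimal energy `W_s(E) = inf {I_s(μ) : μ ∈ M(E)}`. -/
def minEnergy {m : ℕ} (s : ℝ) (E : Set (EuclideanSpace ℝ (Fin m))) : ENNReal :=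
  ⨅ μ ∈ unitMeasures E, rieszEnergy s μ

/-- The Riesz `s`-capacity `cap_s(E) = 1 / W_s(E)`. -/
def rieszCapacity {m : ℕ} (s : ℝ) (E : Set (EuclideanSpace ℝ (Fin m))) : ENNReal :=
  1 / minEnergy s E

/-- `μ` is a Riesz `s`-equilibrium measure of `E`: it lies in `M(E)` and its energy is the minimal
one. -/
def IsEquilibriumMeasure {m : ℕ} (s : ℝ) (E : Set (EuclideanSpace ℝ (Fin m)))
    (μ : Measure (EuclideanSpace ℝ (Fin m))) : Prop :=
  μ ∈ unitMeasures E ∧ rieszEnergy s μ = minEnergy s E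

/-- The flat disk `{x ∈ ℝ^(n+1) : x₁ = 0, x₂² + ... + x_{n+1}² ≤ R²}`. -/
def disk (n : ℕ) (R : ℝ) : Set (EuclideanSpace ℝ (Fin (n + 1))) :=
  {x | x 0 = 0 ∧ ∑ i : Fin n, x i.succ ^ 2 ≤ R ^ 2}

/-- The point `(0, r u)` of `ℝ^(n+1)` with polar coordinates `r` and `u`, `u` in the unit sphere
of `ℝ^n`. -/
def polarPoint (n : ℕ) (p : ℝ × Metric.sphere (0 : EuclideanSpace ℝ (Fin n)) 1) :
    EuclideanSpace ℝ (Fin (n + 1)) :=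
  WithLp.toLp 2 (Matrix.vecCons 0 fun i => p.1 * (p.2 : EuclideanSpace ℝ (Fin n)) i)

/-- The surface measure of the unit sphere of `ℝ^n`. -/
def surfaceMeasure (n : ℕ) : Measure (Metric.sphere (0 : EuclideanSpace ℝ (Fin n)) 1) :=
  (volume : Measure (EuclideanSpace ℝ (Fin n))).toSphere

/-- The measure `f(r) r^(n-1) dr dσ(u)` at the points `(0, r u)` of the disk, with `0 ≤ r ≤ R` and
`u` in the unit sphere of `ℝ^n`. -/
def radialMeasure (n : ℕ) (R : ℝ) (f : ℝ → ℝ) : Measure (EuclideanSpace ℝ (Fin (n + 1))) :=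
  Measure.map (polarPoint n)
    (((volume.restrict (Set.Icc 0 R)).withDensity
      fun r => ENNReal.ofReal (f r * r ^ (n - 1))).prod (surfaceMeasure n))

end

end RieszDisk

/-! Everything follows from one fact: the proposed measure ν has potential equal to a finite
constant W at every point of the disk. Then I(μ, ν) = W for each unit measure μ on the disk, and in
particular I(ν) = W. The kernel is positive definite, 2 I(μ, ν) ≤ I(μ) + I(ν), so I(μ) ≥ W; strict
definiteness turns equality into μ = ν (`isEquilibriumMeasure_iff_of_potential_const`).

Definiteness comes from writing |x - y|^(-s) as a superposition of products g(x) g(y) of Gaussians,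
which reduces the inequality to 2ab ≤ a² + b². In the equality case the Gaussian transforms of μ and
ν agree almost everywhere, and one width already determines a finite measure
(`measure_eq_of_integral_gauss_eq`).

For the potential, put n = d - 1 and β = 1 - λ, so s = n - 2β, and use polar coordinates in ℝ^n
about the point x. Along a ray the integrand is ρ^(2β-1) (C + 2pρ - ρ²)^(-β), with C = R² - |x|² and
p = -⟨x, θ⟩. A substitution gives each ray a beta integrand times 1 + (an odd function of p), so
opposite rays add up to B(β, 1 - β), whatever x and θ are (`lintegral_rayDensity_add`). The total
mass is another beta integral; the quotient of the two is W. -/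

namespace RieszDisk

open Set Real

/-! ### Gaussian superposition and positive definiteness of the Riesz kernel -/

section PositiveDefinite

variable {m : ℕ}

/-- The Gaussian factors whose superposition is a multiple of the Riesz kernel. -/
noncomputable def gaussFactor (m : ℕ) (s : ℝ) (p : ℝ × EuclideanSpace ℝ (Fin m))
    (x : EuclideanSpace ℝ (Fin m)) : ENNReal :=
  ENNReal.ofReal (p.1 ^ ((s / 2 - 1 + m / 2) / 2) * exp (-p.1 * ‖x - p.2‖ ^ 2))

/-- The parameter measure `dt dz` on `(0, ∞) × ℝ^m`. -/
noncomputable def gaussParam (m : ℕ) : Measure (ℝ × EuclideanSpace ℝ (Fin m)) :=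
  (volume.restrict (Ioi 0)).prod volume

instance sFinite_gaussParam : SFinite (gaussParam m) := by
  unfold gaussParam; infer_instance

lemma measurable_gaussFactor (m : ℕ) (s : ℝ) :
    Measurable (Function.uncurry (gaussFactor m s)) := by
  unfold gaussFactor Function.uncurry
  fun_prop

lemma norm_sub_sq_add_norm_sub_sq (x y z : EuclideanSpace ℝ (Fin m)) :
    ‖x - (z + (1 / 2 : ℝ) • (x + y))‖ ^ 2 + ‖y - (z + (1 / 2 : ℝ) • (x + y))‖ ^ 2
      = 2 * ‖z‖ ^ 2 + ‖x - y‖ ^ 2 / 2 := by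
  have h1 : x - (z + (1 / 2 : ℝ) • (x + y)) = (1 / 2 : ℝ) • (x - y) - z := by module
  have h2 : y - (z + (1 / 2 : ℝ) • (x + y)) = -((1 / 2 : ℝ) • (x - y) + z) := by module
  rw [h1, h2, norm_neg]
  have := parallelogram_law_with_norm ℝ ((1 / 2 : ℝ) • (x - y)) z
  have h3 : ‖(1 / 2 : ℝ) • (x - y)‖ = ‖x - y‖ / 2 := by
    rw [norm_smul]; norm_num; ring
  rw [h3] at this
  nlinarith

lemma lintegral_exp_neg_mul_norm_sq {b : ℝ} (hb : 0 < b) :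
    ∫⁻ z : EuclideanSpace ℝ (Fin m), ENNReal.ofReal (exp (-b * ‖z‖ ^ 2))
      = ENNReal.ofReal ((π / b) ^ (m / 2 : ℝ)) := by
  have h := GaussianFourier.integral_rexp_neg_mul_sq_norm (V := EuclideanSpace ℝ (Fin m)) hb
  rw [finrank_euclideanSpace, Fintype.card_fin] at h
  -- A Bochner integral defaults to 0 when the integrand is not integrable, so a nonzero value
  -- yields integrability.
  have hne : ∫ v : EuclideanSpace ℝ (Fin m), rexp (-b * ‖v‖ ^ 2) ≠ 0 := by
    rw [h]; positivity
  rw [← h, ofReal_integral_eq_lintegral_ofReal (not_imp_comm.1 integral_undef hne)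
    (ae_of_all _ fun _ => (exp_pos _).le)]

lemma lintegral_gaussFactor_mul_space {s t : ℝ} (ht : 0 < t) (x y : EuclideanSpace ℝ (Fin m)) :
    ∫⁻ z, gaussFactor m s (t, z) x * gaussFactor m s (t, z) y
      = ENNReal.ofReal ((π / 2) ^ (m / 2 : ℝ)) *
        ENNReal.ofReal (t ^ (s / 2 - 1) * exp (-(‖x - y‖ ^ 2 / 2 * t))) := by
  -- Centring z at the midpoint of x and y decouples z from x - y, by the parallelogram law.
  rw [← lintegral_add_right_eq_self _ ((1 / 2 : ℝ) • (x + y))]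
  have h : ∀ z, gaussFactor m s (t, z + (1 / 2 : ℝ) • (x + y)) x *
      gaussFactor m s (t, z + (1 / 2 : ℝ) • (x + y)) y =
      ENNReal.ofReal (t ^ (s / 2 - 1 + m / 2) * exp (-(‖x - y‖ ^ 2 / 2 * t))) *
        ENNReal.ofReal (exp (-(2 * t) * ‖z‖ ^ 2)) := by
    intro z
    unfold gaussFactor
    simp only
    rw [← ENNReal.ofReal_mul (by positivity), ← ENNReal.ofReal_mul (by positivity),
      mul_mul_mul_comm, ← rpow_add ht, ← exp_add, mul_assoc, ← exp_add, add_halves]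
    congr 3
    linear_combination (-t) * norm_sub_sq_add_norm_sub_sq x y z
  simp_rw [h]
  rw [lintegral_const_mul _ (by fun_prop), lintegral_exp_neg_mul_norm_sq (by positivity),
    ← ENNReal.ofReal_mul (by positivity), ← ENNReal.ofReal_mul (by positivity)]
  congr 1
  rw [show π / (2 * t) = (π / 2) * t⁻¹ by field_simp, mul_rpow (by positivity) (by positivity),
    rpow_add ht, inv_rpow ht.le]
  field_simp

/-- The ratio between the superposition of Gaussians and the Riesz kernel. -/
noncomputable def gaussConst (m : ℕ) (s : ℝ) : ENNReal :=
  ENNReal.ofReal ((π / 2) ^ (m / 2 : ℝ)) * ENNReal.ofReal (2 ^ (s / 2) * Gamma (s / 2))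

lemma gaussConst_ne_zero {s : ℝ} (hs : 0 < s) : gaussConst m s ≠ 0 := by
  unfold gaussConst
  have := Gamma_pos_of_pos (half_pos hs)
  refine mul_ne_zero ?_ ?_ <;> simp only [ne_eq, ENNReal.ofReal_eq_zero, not_le] <;> positivity

lemma gaussConst_ne_top {s : ℝ} : gaussConst m s ≠ ⊤ :=
  ENNReal.mul_ne_top ENNReal.ofReal_ne_top ENNReal.ofReal_ne_top

lemma lintegral_rpow_mul_exp_neg_mul {a r : ℝ} (ha : 0 < a) (hr : 0 < r) :
    ∫⁻ t in Ioi (0 : ℝ), ENNReal.ofReal (t ^ (a - 1) * exp (-(r * t)))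
      = ENNReal.ofReal ((1 / r) ^ a * Gamma a) := by
  have h := integral_rpow_mul_exp_neg_mul_Ioi ha hr
  have := Gamma_pos_of_pos ha
  rw [← h, ofReal_integral_eq_lintegral_ofReal (not_imp_comm.1 integral_undef
    (by rw [h]; positivity))]
  filter_upwards [ae_restrict_mem measurableSet_Ioi] with t (ht : 0 < t)
  positivity

lemma lintegral_rpow_Ioi_eq_top (a : ℝ) :
    ∫⁻ t in Ioi (0 : ℝ), ENNReal.ofReal (t ^ a) = ⊤ := by
  by_contra hne
  refine not_integrableOn_Ioi_rpow a ⟨Measurable.aestronglyMeasurable (by fun_prop), ?_⟩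
  rw [hasFiniteIntegral_iff_ofReal]
  · exact lt_top_iff_ne_top.2 hne
  · filter_upwards [ae_restrict_mem measurableSet_Ioi] with t (ht : 0 < t)
    positivity

lemma rieszKernel_of_ne {s : ℝ} {x y : EuclideanSpace ℝ (Fin m)} (h : x ≠ y) :
    rieszKernel s x y = ENNReal.ofReal (‖x - y‖ ^ (-s)) := by
  have hpos : 0 < ‖x - y‖ := norm_pos_iff.2 (sub_ne_zero.2 h)
  rw [rieszKernel, edist_dist, dist_eq_norm, ENNReal.ofReal_rpow_of_pos hpos, one_div,
    ← ENNReal.ofReal_inv_of_pos (by positivity), rpow_neg hpos.le]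

lemma rieszKernel_self {s : ℝ} (hs : 0 < s) (x : EuclideanSpace ℝ (Fin m)) :
    rieszKernel s x x = ⊤ := by
  simp [rieszKernel, hs]

/-- The z-integral costs a factor t^(-m/2), which the exponent in `gaussFactor` compensates; what
remains is the Gamma integral of t^(s/2-1) exp(-t|x-y|²/2). On the diagonal both sides are infinite,
so no bound s < m is needed. -/
lemma lintegral_gaussFactor_mul {s : ℝ} (hs : 0 < s) (x y : EuclideanSpace ℝ (Fin m)) :
    ∫⁻ p, gaussFactor m s p x * gaussFactor m s p y ∂(gaussParam m)
      = gaussConst m s * rieszKernel s x y := by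
  have hm : ∀ x, Measurable fun p => gaussFactor m s p x := fun x =>
    (measurable_gaussFactor m s).comp (measurable_id.prodMk measurable_const)
  rw [gaussParam, lintegral_prod (fun p => gaussFactor m s p x * gaussFactor m s p y)
    ((hm x).mul (hm y)).aemeasurable]
  rw [setLIntegral_congr_fun measurableSet_Ioi
    fun t ht => lintegral_gaussFactor_mul_space (s := s) ht x y]
  rw [lintegral_const_mul' _ _ ENNReal.ofReal_ne_top, gaussConst, mul_assoc]
  congr 1
  rcases eq_or_ne x y with rfl | hxy
  · have hg := Gamma_pos_of_pos (half_pos hs)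
    simp only [sub_self, norm_zero, ne_eq, OfNat.ofNat_ne_zero, not_false_eq_true, zero_pow,
      zero_div, zero_mul, neg_zero, exp_zero, mul_one]
    rw [lintegral_rpow_Ioi_eq_top, rieszKernel_self hs, ENNReal.mul_top]
    simp only [ne_eq, ENNReal.ofReal_eq_zero, not_le]
    positivity
  · have hpos : 0 < ‖x - y‖ := norm_pos_iff.2 (sub_ne_zero.2 hxy)
    rw [lintegral_rpow_mul_exp_neg_mul (half_pos hs) (by positivity), rieszKernel_of_ne hxy,
      ← ENNReal.ofReal_mul' (by positivity)]
    congr 1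
    rw [show 1 / (‖x - y‖ ^ 2 / 2) = 2 * (‖x - y‖ ^ (-2 : ℝ)) by
      rw [rpow_neg hpos.le, Real.rpow_two]; field_simp, mul_rpow (by positivity) (by positivity),
      ← rpow_mul hpos.le]
    ring_nf

/-- The mutual Riesz energy of two measures. -/
noncomputable def mutualEnergy (s : ℝ) (μ ν : Measure (EuclideanSpace ℝ (Fin m))) : ENNReal :=
  ∫⁻ x, ∫⁻ y, rieszKernel s x y ∂ν ∂μ

/-- The Gaussian transform of a measure. -/
noncomputable def gaussTransform (s : ℝ) (μ : Measure (EuclideanSpace ℝ (Fin m)))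
    (p : ℝ × EuclideanSpace ℝ (Fin m)) : ENNReal :=
  ∫⁻ x, gaussFactor m s p x ∂μ

lemma measurable_gaussTransform (s : ℝ) (μ : Measure (EuclideanSpace ℝ (Fin m))) [SFinite μ] :
    Measurable (gaussTransform s μ) :=
  (measurable_gaussFactor m s).lintegral_prod_right

lemma gaussConst_mul_mutualEnergy {s : ℝ} (hs : 0 < s)
    (μ ν : Measure (EuclideanSpace ℝ (Fin m))) [SFinite μ] [SFinite ν] :
    gaussConst m s * mutualEnergy s μ ν
      = ∫⁻ p, gaussTransform s μ p * gaussTransform s ν p ∂(gaussParam m) := by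
  have hG := measurable_gaussFactor m s
  have hm : ∀ x, Measurable fun p => gaussFactor m s p x := fun x =>
    hG.comp (measurable_id.prodMk measurable_const)
  have hx : ∀ p, Measurable fun x => gaussFactor m s p x := fun p =>
    hG.comp (measurable_const.prodMk measurable_id)
  have hflip : Measurable fun q : (EuclideanSpace ℝ (Fin m)) × (ℝ × EuclideanSpace ℝ (Fin m)) =>
      gaussFactor m s q.2 q.1 := hG.comp measurable_swap
  have h1 : ∀ x, ∫⁻ y, gaussConst m s * rieszKernel s x y ∂ν
      = ∫⁻ p, gaussFactor m s p x * gaussTransform s ν p ∂(gaussParam m) := by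
    intro x
    simp_rw [← lintegral_gaussFactor_mul hs]
    rw [lintegral_lintegral_swap]
    · refine lintegral_congr fun p => ?_
      rw [lintegral_const_mul _ (hx p), gaussTransform]
    · exact (((hm x).comp measurable_snd).mul hflip).aemeasurable
  rw [mutualEnergy, ← lintegral_const_mul' _ _ gaussConst_ne_top]
  simp_rw [← lintegral_const_mul' _ _ (gaussConst_ne_top (m := m) (s := s)), h1]
  rw [lintegral_lintegral_swap]
  · refine lintegral_congr fun p => ?_
    rw [lintegral_mul_const _ (hx p)]
    rfl
  · exact (hflip.mul ((measurable_gaussTransform s ν).comp measurable_snd)).aemeasurable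

lemma two_mul_le_sq_add_sq (a b : ENNReal) : 2 * (a * b) ≤ a * a + b * b := by
  induction a using ENNReal.recTopCoe with
  | top => simp
  | coe a =>
    induction b using ENNReal.recTopCoe with
    | top => simp
    | coe b =>
      norm_cast
      have := two_mul_le_add_sq (a : ℝ) b
      rw [← NNReal.coe_le_coe]
      push_cast
      nlinarith

lemma eq_of_sq_add_sq_eq {a b : ENNReal} (ha : a ≠ ⊤) (hb : b ≠ ⊤)
    (h : 2 * (a * b) = a * a + b * b) : a = b := by
  lift a to NNReal using ha
  lift b to NNReal using hb
  norm_cast at h ⊢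
  rw [← NNReal.coe_inj] at h ⊢
  push_cast at h
  nlinarith [sq_nonneg ((a : ℝ) - b), sq_eq_zero_iff.1 (show ((a : ℝ) - b) ^ 2 = 0 by linarith)]

lemma two_mul_mutualEnergy_le {s : ℝ} (hs : 0 < s)
    (μ ν : Measure (EuclideanSpace ℝ (Fin m))) [SFinite μ] [SFinite ν] :
    2 * mutualEnergy s μ ν ≤ mutualEnergy s μ μ + mutualEnergy s ν ν := by
  rw [← ENNReal.mul_le_mul_iff_right (gaussConst_ne_zero (m := m) hs) gaussConst_ne_top, mul_add,
    mul_left_comm, gaussConst_mul_mutualEnergy hs, gaussConst_mul_mutualEnergy hs,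
    gaussConst_mul_mutualEnergy hs, ← lintegral_const_mul' _ _ (by simp),
    ← lintegral_add_left ((measurable_gaussTransform s μ).fun_mul (measurable_gaussTransform s μ))]
  exact lintegral_mono fun p => two_mul_le_sq_add_sq _ _

lemma gaussTransform_ne_top {s : ℝ} (μ : Measure (EuclideanSpace ℝ (Fin m))) [IsFiniteMeasure μ]
    {p : ℝ × EuclideanSpace ℝ (Fin m)} (hp : 0 < p.1) : gaussTransform s μ p ≠ ⊤ := by
  refine ((lintegral_mono (g := fun _ => ENNReal.ofReal (p.1 ^ ((s / 2 - 1 + m / 2) / 2)))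
    fun x => ?_).trans_lt ?_).ne
  · refine ENNReal.ofReal_le_ofReal (mul_le_of_le_one_right (by positivity) ?_)
    rw [exp_le_one_iff]
    nlinarith [sq_nonneg ‖x - p.2‖]
  · rw [lintegral_const]
    exact ENNReal.mul_lt_top ENNReal.ofReal_lt_top (measure_lt_top _ _)

/-- Equality of finite integrals forces equality almost everywhere in 2ab ≤ a² + b². Concluding a =
b also needs finite a and b, which holds for t > 0. -/
lemma gaussTransform_ae_eq {s : ℝ} (hs : 0 < s)
    (μ ν : Measure (EuclideanSpace ℝ (Fin m))) [IsFiniteMeasure μ] [IsFiniteMeasure ν]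
    (hfin : mutualEnergy s μ μ + mutualEnergy s ν ν ≠ ⊤)
    (h : mutualEnergy s μ μ + mutualEnergy s ν ν ≤ 2 * mutualEnergy s μ ν) :
    gaussTransform s μ =ᵐ[gaussParam m] gaussTransform s ν := by
  have hu := measurable_gaussTransform s μ
  have hv := measurable_gaussTransform s ν
  have e1 : ∫⁻ p, (gaussTransform s μ p * gaussTransform s μ p
      + gaussTransform s ν p * gaussTransform s ν p) ∂(gaussParam m)
      = gaussConst m s * (mutualEnergy s μ μ + mutualEnergy s ν ν) := by
    rw [lintegral_add_left (hu.fun_mul hu), mul_add, gaussConst_mul_mutualEnergy hs,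
      gaussConst_mul_mutualEnergy hs]
  have e2 : ∫⁻ p, 2 * (gaussTransform s μ p * gaussTransform s ν p) ∂(gaussParam m)
      = gaussConst m s * (2 * mutualEnergy s μ ν) := by
    rw [lintegral_const_mul' _ _ (by simp), mul_left_comm, gaussConst_mul_mutualEnergy hs]
  have hpos : ∀ᵐ p ∂(gaussParam m), 0 < p.1 := by
    have : gaussParam m = (volume.prod volume).restrict (Ioi 0 ×ˢ univ) := by
      rw [gaussParam, ← Measure.prod_restrict, Measure.restrict_univ]
    rw [this]
    filter_upwards [ae_restrict_mem (measurableSet_Ioi.prod MeasurableSet.univ)] with p hp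
    exact hp.1
  have key := ae_eq_of_ae_le_of_lintegral_le
    (ae_of_all (gaussParam m) fun p => two_mul_le_sq_add_sq (gaussTransform s μ p)
      (gaussTransform s ν p))
    (by
      rw [e2]
      exact ENNReal.mul_ne_top gaussConst_ne_top
        ((two_mul_mutualEnergy_le hs μ ν).trans_lt (lt_top_iff_ne_top.2 hfin)).ne)
    ((hu.mul hu).add (hv.mul hv)).aemeasurable
    (by rw [e1, e2]; gcongr)
  filter_upwards [key, hpos] with p hp h0
  exact eq_of_sq_add_sq_eq (gaussTransform_ne_top μ h0) (gaussTransform_ne_top ν h0) hp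

end PositiveDefinite

/-! ### A finite measure is determined by its Gaussian convolution at one width -/

section GaussianInjectivity

variable {m : ℕ}

lemma integrable_exp_neg_mul_norm_sub_sq (μ : Measure (EuclideanSpace ℝ (Fin m)))
    [IsFiniteMeasure μ] {t : ℝ} (ht : 0 < t) (z : EuclideanSpace ℝ (Fin m)) :
    Integrable (fun x => exp (-t * ‖x - z‖ ^ 2)) μ := by
  refine Integrable.of_bound (C := 1) (Continuous.aestronglyMeasurable (by fun_prop))
    (ae_of_all _ fun x => ?_)
  rw [norm_of_nonneg (exp_pos _).le, exp_le_one_iff]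
  nlinarith [sq_nonneg ‖x - z‖]

lemma continuous_integral_exp_neg_mul_norm_sub_sq (μ : Measure (EuclideanSpace ℝ (Fin m)))
    [IsFiniteMeasure μ] {t : ℝ} (ht : 0 < t) :
    Continuous fun z => ∫ x, exp (-t * ‖x - z‖ ^ 2) ∂μ := by
  refine continuous_of_dominated (bound := fun _ => 1)
    (fun z => Continuous.aestronglyMeasurable (by fun_prop)) (fun z => ae_of_all _ fun x => ?_)
    (integrable_const _) (ae_of_all _ fun x => by fun_prop)
  rw [norm_of_nonneg (exp_pos _).le, exp_le_one_iff]
  nlinarith [sq_nonneg ‖x - z‖]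

lemma gaussTransform_eq (s : ℝ) (μ : Measure (EuclideanSpace ℝ (Fin m))) [IsFiniteMeasure μ]
    {t : ℝ} (ht : 0 < t) (z : EuclideanSpace ℝ (Fin m)) :
    gaussTransform s μ (t, z) = ENNReal.ofReal
      (t ^ ((s / 2 - 1 + m / 2) / 2) * ∫ x, exp (-t * ‖x - z‖ ^ 2) ∂μ) := by
  rw [← integral_const_mul, ofReal_integral_eq_lintegral_ofReal]
  · rfl
  · exact (integrable_exp_neg_mul_norm_sub_sq μ ht z).const_mul _
  · exact ae_of_all _ fun x => by positivity

/-- By Fubini some single t works for almost every z; continuity in z then removes the exceptional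
set. -/
lemma exists_integral_gauss_eq {s : ℝ} (μ ν : Measure (EuclideanSpace ℝ (Fin m)))
    [IsFiniteMeasure μ] [IsFiniteMeasure ν]
    (h : gaussTransform s μ =ᵐ[gaussParam m] gaussTransform s ν) :
    ∃ t : ℝ, 0 < t ∧ ∀ z, ∫ x, exp (-t * ‖x - z‖ ^ 2) ∂μ = ∫ x, exp (-t * ‖x - z‖ ^ 2) ∂ν := by
  have h1 : ∀ᵐ t ∂(volume.restrict (Ioi (0 : ℝ))), ∀ᵐ z ∂(volume : Measure (EuclideanSpace ℝ (Fin m))),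
      gaussTransform s μ (t, z) = gaussTransform s ν (t, z) := Measure.ae_ae_of_ae_prod h
  have : (ae (volume.restrict (Ioi (0 : ℝ)))).NeBot := by
    rw [ae_neBot, Ne, Measure.restrict_eq_zero]
    simp
  obtain ⟨t, hz, ht⟩ := (h1.and (ae_restrict_mem measurableSet_Ioi)).exists
  have ht : 0 < t := ht
  refine ⟨t, ht, fun z => ?_⟩
  refine congrFun ((Continuous.ae_eq_iff_eq volume
    (continuous_integral_exp_neg_mul_norm_sub_sq μ ht)
    (continuous_integral_exp_neg_mul_norm_sub_sq ν ht)).1 ?_) z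
  filter_upwards [hz] with z hz
  rw [gaussTransform_eq s μ ht, gaussTransform_eq s ν ht,
    ENNReal.ofReal_eq_ofReal_iff (by positivity) (by positivity)] at hz
  exact mul_left_cancel₀ (by positivity) hz

/-- Finite measures with equal Gaussian convolutions, at one fixed width, are equal. -/
lemma measure_eq_of_integral_gauss_eq (μ ν : Measure (EuclideanSpace ℝ (Fin m)))
    [IsFiniteMeasure μ] [IsFiniteMeasure ν] {t : ℝ} (ht : 0 < t)
    (h : ∀ z, ∫ x, exp (-t * ‖x - z‖ ^ 2) ∂μ = ∫ x, exp (-t * ‖x - z‖ ^ 2) ∂ν) : μ = ν := by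
  let w : EuclideanSpace ℝ (Fin m) → NNReal := fun x => Real.toNNReal (exp (-t * ‖x‖ ^ 2))
  have hw : Measurable w := by fun_prop
  have hw0 : ∀ x, (w x : ENNReal) ≠ 0 := fun x => by
    simp [w, exp_pos]
  have hfin : ∀ (ρ : Measure (EuclideanSpace ℝ (Fin m))) [IsFiniteMeasure ρ],
      IsFiniteMeasure (ρ.withDensity fun x => (w x : ENNReal)) := by
    intro ρ _
    refine isFiniteMeasure_withDensity ((lintegral_mono (g := fun _ => 1) fun x => ?_).trans_lt ?_).ne
    · simp only [w, ENNReal.coe_le_one_iff, toNNReal_le_one, exp_le_one_iff]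
      nlinarith [sq_nonneg ‖x‖]
    · simp
  -- Completing the square: a Gaussian centred at v/(2t) is, up to a constant, the weight `w` times
  -- exp⟨x, v⟩. Gaussian convolutions of ρ are thus Laplace transforms of the weighted measure.
  have hexp : ∀ x v : EuclideanSpace ℝ (Fin m),
      w x • exp (inner ℝ x v) = exp (‖v‖ ^ 2 / (4 * t)) * exp (-t * ‖x - (1 / (2 * t)) • v‖ ^ 2) := by
    intro x v
    rw [NNReal.smul_def, smul_eq_mul, Real.coe_toNNReal _ (exp_pos _).le, ← exp_add, ← exp_add,
      norm_sub_sq_real, inner_smul_right, norm_smul, mul_pow, norm_eq_abs, sq_abs]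
    congr 1
    field_simp
    ring
  have hint : ∀ (ρ : Measure (EuclideanSpace ℝ (Fin m))) [IsFiniteMeasure ρ] v,
      Integrable (fun x => exp (inner ℝ x v)) (ρ.withDensity fun x => (w x : ENNReal)) := by
    intro ρ _ v
    rw [integrable_withDensity_iff_integrable_smul hw]
    simp_rw [hexp]
    exact (integrable_exp_neg_mul_norm_sub_sq ρ ht _).const_mul _
  have hval : ∀ (ρ : Measure (EuclideanSpace ℝ (Fin m))) [IsFiniteMeasure ρ] v,
      ∫ x, exp (inner ℝ x v) ∂(ρ.withDensity fun x => (w x : ENNReal))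
        = exp (‖v‖ ^ 2 / (4 * t)) * ∫ x, exp (-t * ‖x - (1 / (2 * t)) • v‖ ^ 2) ∂ρ := by
    intro ρ _ v
    rw [integral_withDensity_eq_integral_smul hw]
    simp_rw [hexp]
    rw [integral_const_mul]
  have key : μ.withDensity (fun x => (w x : ENNReal)) = ν.withDensity (fun x => (w x : ENNReal)) := by
    have := hfin μ
    have := hfin ν
    -- At v = 0 the Laplace transforms are the total masses, so the weighted measures vanish
    -- together, as the uniqueness theorem for `complexMGF` requires.
    have hzero : μ.withDensity (fun x => (w x : ENNReal)) = 0 ↔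
        ν.withDensity (fun x => (w x : ENNReal)) = 0 := by
      have h0 := (hval μ 0).trans ((congrArg _ (h _)).trans (hval ν 0).symm)
      simp only [inner_zero_right, exp_zero, integral_const, smul_eq_mul, mul_one] at h0
      rw [← Measure.measure_univ_eq_zero, ← Measure.measure_univ_eq_zero,
        ← measureReal_eq_zero_iff, ← measureReal_eq_zero_iff, h0]
    refine Measure.ext_of_charFun (funext fun v => ?_)
    have hmgf : ProbabilityTheory.mgf (fun x => inner ℝ x v)
          (μ.withDensity fun x => (w x : ENNReal))
        = ProbabilityTheory.mgf (fun x => inner ℝ x v)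
          (ν.withDensity fun x => (w x : ENNReal)) := by
      funext r
      simp only [ProbabilityTheory.mgf]
      simp_rw [← real_inner_smul_right]
      rw [hval μ, hval ν, h]
    have hset : ProbabilityTheory.integrableExpSet (fun x => inner ℝ x v)
        (μ.withDensity fun x => (w x : ENNReal)) = univ := by
      refine eq_univ_of_forall fun r => ?_
      simp only [ProbabilityTheory.integrableExpSet, mem_ofPred_eq]
      simp_rw [← real_inner_smul_right]
      exact hint μ _
    -- The Laplace transform is finite on all of ℝ, so analytic continuation reaches the point i,
    -- where it is the characteristic function.
    have := ProbabilityTheory.eqOn_complexMGF_of_mgf' hmgf hzero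
      (show Complex.I ∈ _ by simp [hset])
    simpa [charFun_apply, ProbabilityTheory.complexMGF, mul_comm] using this
  have hback : ∀ (ρ : Measure (EuclideanSpace ℝ (Fin m))),
      (ρ.withDensity fun x => (w x : ENNReal)).withDensity (fun x => (w x : ENNReal)⁻¹) = ρ :=
    fun ρ => withDensity_inv_same (by fun_prop) (ae_of_all _ hw0) (ae_of_all _ fun _ => by simp)
  rw [← hback μ, key, hback ν]

/-- Measures of finite energy whose mutual energy is maximal are equal: the Riesz kernel is
strictly positive definite. -/
lemma eq_of_mutualEnergy_le {s : ℝ} (hs : 0 < s)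
    (μ ν : Measure (EuclideanSpace ℝ (Fin m))) [IsFiniteMeasure μ] [IsFiniteMeasure ν]
    (hfin : mutualEnergy s μ μ + mutualEnergy s ν ν ≠ ⊤)
    (h : mutualEnergy s μ μ + mutualEnergy s ν ν ≤ 2 * mutualEnergy s μ ν) : μ = ν := by
  obtain ⟨t, ht, hz⟩ := exists_integral_gauss_eq μ ν (gaussTransform_ae_eq hs μ ν hfin h)
  exact measure_eq_of_integral_gauss_eq μ ν ht hz

end GaussianInjectivity

/-! ### Beta integrals along the two halves of a chord -/

section Chord

open ProbabilityTheory

lemma lintegral_rpow_mul_one_sub_rpow {a b : ℝ} (ha : 0 < a) (hb : 0 < b) :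
    ∫⁻ x in Ioo (0 : ℝ) 1, ENNReal.ofReal (x ^ (a - 1) * (1 - x) ^ (b - 1))
      = ENNReal.ofReal (beta a b) := by
  have h := lintegral_betaPDF_eq_one ha hb
  have hpos := beta_pos ha hb
  rw [lintegral_betaPDF] at h
  have h2 : ∀ x : ℝ, ENNReal.ofReal (1 / beta a b * x ^ (a - 1) * (1 - x) ^ (b - 1))
      = ENNReal.ofReal (1 / beta a b) * ENNReal.ofReal (x ^ (a - 1) * (1 - x) ^ (b - 1)) := by
    intro x
    rw [mul_assoc, ENNReal.ofReal_mul (by positivity)]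
  simp_rw [h2] at h
  rw [lintegral_const_mul' _ _ ENNReal.ofReal_ne_top, one_div, ENNReal.ofReal_inv_of_pos hpos] at h
  have h3 := congrArg (fun z => ENNReal.ofReal (beta a b) * z) h
  simp only [mul_one] at h3
  rwa [← mul_assoc, ENNReal.mul_inv_cancel (by simpa using hpos) ENNReal.ofReal_ne_top,
    one_mul] at h3

lemma image_sq_Ioo_zero_one : (fun r : ℝ => r ^ 2) '' Ioo 0 1 = Ioo 0 1 := by
  ext x
  constructor
  · rintro ⟨r, ⟨h0, h1⟩, rfl⟩
    exact ⟨by positivity, by simp only; nlinarith⟩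
  · rintro ⟨h0, h1⟩
    exact ⟨√x, ⟨sqrt_pos.2 h0, by rw [sqrt_lt' one_pos]; simpa using h1⟩, sq_sqrt h0.le⟩

lemma lintegral_rpow_mul_one_sub_sq_rpow {a b : ℝ} (ha : 0 < a) (hb : 0 < b) :
    2 * ∫⁻ r in Ioo (0 : ℝ) 1, ENNReal.ofReal (r ^ (2 * a - 1) * (1 - r ^ 2) ^ (b - 1))
      = ENNReal.ofReal (beta a b) := by
  rw [← lintegral_rpow_mul_one_sub_rpow ha hb]
  conv_rhs => rw [← image_sq_Ioo_zero_one]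
  rw [lintegral_image_eq_lintegral_abs_deriv_mul (f' := fun r => 2 * r) measurableSet_Ioo
    (fun x _ => by simpa using (hasDerivAt_pow 2 x).hasDerivWithinAt)
    (fun x hx y hy h => (sq_eq_sq₀ hx.1.le hy.1.le).1 h), ← lintegral_const_mul' _ _ (by simp)]
  refine setLIntegral_congr_fun measurableSet_Ioo fun r hr => ?_
  have hr0 : 0 < r := hr.1
  rw [abs_of_pos (by positivity), ← ENNReal.ofReal_mul (by positivity),
    show (2 : ENNReal) = ENNReal.ofReal 2 by simp, ← ENNReal.ofReal_mul (by positivity)]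
  congr 1
  rw [← rpow_natCast, ← rpow_mul hr0.le, show 2 * a - 1 = 1 + (2 : ℕ) * (a - 1) by push_cast; ring,
    rpow_add hr0, rpow_one]
  ring

/-- The substitution that turns the chord integrals into beta integrals. -/
noncomputable def chordParam (C p m : ℝ) : ℝ := m * (p * m + √(C + p ^ 2 * m ^ 2))

section

variable {C p m : ℝ}

lemma chord_radicand_pos (hC : 0 ≤ C) (h : 0 < C ∨ 0 < p) (hm : 0 < m) :
    0 < C + p ^ 2 * m ^ 2 := by
  rcases h with h | h <;> positivity

lemma chord_factor_pos (hC : 0 ≤ C) (h : 0 < C ∨ 0 < p) (hm : 0 < m) :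
    0 < p * m + √(C + p ^ 2 * m ^ 2) := by
  rcases h with h | h
  · have : |p * m| < √(C + p ^ 2 * m ^ 2) := by
      rw [lt_sqrt (abs_nonneg _), sq_abs]; nlinarith
    linarith [(abs_lt.1 this).1, neg_abs_le (p * m)]
  · positivity

/-- Write q = pm + √(C + p²m²) and ρ = mq. Then q solves q² - 2pmq - C = 0, that is q² = C + 2pρ, so
the substitution is inverted by m = ρ/√(C + 2pρ). -/
lemma chord_factor_sq (hC : 0 ≤ C) :
    (p * m + √(C + p ^ 2 * m ^ 2)) ^ 2 = C + 2 * p * chordParam C p m := by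
  have := sq_sqrt (show 0 ≤ C + p ^ 2 * m ^ 2 by positivity)
  unfold chordParam
  linear_combination this

lemma chord_quadratic (hC : 0 ≤ C) :
    C + 2 * p * chordParam C p m - chordParam C p m ^ 2
      = (p * m + √(C + p ^ 2 * m ^ 2)) ^ 2 * (1 - m ^ 2) := by
  rw [← chord_factor_sq hC, chordParam]
  ring

lemma hasDerivAt_chordParam (hC : 0 ≤ C) (h : 0 < C ∨ 0 < p) (hm : 0 < m) :
    HasDerivAt (chordParam C p)
      ((p * m + √(C + p ^ 2 * m ^ 2)) ^ 2 / √(C + p ^ 2 * m ^ 2)) m := by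
  have hS := chord_radicand_pos hC h hm
  have hS' := sqrt_pos.2 hS
  have h1 : HasDerivAt (fun m => C + p ^ 2 * m ^ 2) (p ^ 2 * (2 * m)) m := by
    simpa using ((hasDerivAt_pow 2 m).const_mul (p ^ 2)).const_add C
  have h2 := (hasDerivAt_id m).mul (((hasDerivAt_id m).const_mul p).add (h1.sqrt hS.ne'))
  refine h2.congr_deriv ?_
  simp only [id, mul_one, one_mul, Pi.add_apply]
  have := sq_sqrt hS.le
  field_simp
  ring

lemma injOn_chordParam (hC : 0 ≤ C) (h : 0 < C ∨ 0 < p) :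
    InjOn (chordParam C p) (Ioo 0 1) := by
  intro x hx y hy hxy
  have hq : p * x + √(C + p ^ 2 * x ^ 2) = p * y + √(C + p ^ 2 * y ^ 2) := by
    rw [← sq_eq_sq₀ (chord_factor_pos hC h hx.1).le (chord_factor_pos hC h hy.1).le,
      chord_factor_sq hC, chord_factor_sq hC, hxy]
  unfold chordParam at hxy
  rw [hq] at hxy
  exact mul_right_cancel₀ (chord_factor_pos hC h hy.1).ne' hxy

lemma image_chordParam (hC : 0 ≤ C) (h : 0 < C ∨ 0 < p) :
    chordParam C p '' Ioo 0 1 = {ρ | 0 < ρ ∧ 0 < C + 2 * p * ρ - ρ ^ 2} := by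
  ext ρ
  constructor
  · rintro ⟨m, hm, rfl⟩
    have hq := chord_factor_pos hC h hm.1
    refine ⟨mul_pos hm.1 hq, ?_⟩
    rw [chord_quadratic hC]
    have : 0 < 1 - m ^ 2 := by nlinarith [hm.1, hm.2]
    positivity
  · rintro ⟨h0, hQ⟩
    have hT2 : 0 < C + 2 * p * ρ := by nlinarith
    set T := √(C + 2 * p * ρ) with hT
    have hTpos : 0 < T := sqrt_pos.2 hT2
    have hTsq : T ^ 2 = C + 2 * p * ρ := sq_sqrt hT2.le
    have hS : √(C + p ^ 2 * (ρ / T) ^ 2) = T - p * (ρ / T) := by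
      rw [sqrt_eq_iff_eq_sq (by positivity)]
      · have : p * (ρ / T) * T = p * ρ := by field_simp
        linear_combination -hTsq + 2 * this
      · have : T - p * (ρ / T) = (T ^ 2 - p * ρ) / T := by field_simp
        rw [this]
        apply div_nonneg _ hTpos.le
        rw [hTsq]; nlinarith
    refine ⟨ρ / T, ⟨by positivity, ?_⟩, ?_⟩
    · rw [div_lt_one hTpos]
      exact lt_of_pow_lt_pow_left₀ 2 hTpos.le (by linarith)
    · rw [chordParam, hS]
      field_simp
      ring

end

/-- The density `ρ ^ (2β - 1) (C + 2pρ - ρ²)₊ ^ (-β)` along a ray. -/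
noncomputable def rayDensity (β C p ρ : ℝ) : ENNReal :=
  ENNReal.ofReal (ρ ^ (2 * β - 1) * max (C + 2 * p * ρ - ρ ^ 2) 0 ^ (-β))

lemma measurable_rayDensity (β C p : ℝ) : Measurable (rayDensity β C p) := by
  unfold rayDensity
  fun_prop

lemma rayDensity_eq_zero {β C p ρ : ℝ} (hβ : 0 < β) (h : C + 2 * p * ρ - ρ ^ 2 ≤ 0) :
    rayDensity β C p ρ = 0 := by
  -- The real power of 0 with nonzero exponent -β is 0, so the truncated density vanishes on and
  -- beyond the sphere instead of blowing up.
  rw [rayDensity, max_eq_right h, zero_rpow (by linarith)]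
  simp

/-- In the variable m the powers of q collapse: q² from the derivative, q^(2β-1) from ρ and q^(-2β)
from the quadratic leave q. Divided by the square root, this is 1 plus a term odd in p. -/
lemma lintegral_rayDensity {β C p : ℝ} (hβ : 0 < β) (hC : 0 ≤ C) (h : 0 < C ∨ 0 < p) :
    ∫⁻ ρ in Ioi 0, rayDensity β C p ρ
      = ∫⁻ m in Ioo 0 1, ENNReal.ofReal (m ^ (2 * β - 1) * (1 - m ^ 2) ^ (-β)) *
          ENNReal.ofReal (1 + p * m / √(C + p ^ 2 * m ^ 2)) := by
  have hA : MeasurableSet {ρ : ℝ | 0 < C + 2 * p * ρ - ρ ^ 2} :=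
    measurableSet_lt measurable_const (by fun_prop)
  have h1 : rayDensity β C p = {ρ : ℝ | 0 < C + 2 * p * ρ - ρ ^ 2}.indicator (rayDensity β C p) := by
    symm
    rw [indicator_eq_self]
    intro ρ hρ
    by_contra hn
    exact hρ (rayDensity_eq_zero hβ (not_lt.1 hn))
  rw [h1, setLIntegral_indicator hA, inter_comm,
    show Ioi 0 ∩ {ρ : ℝ | 0 < C + 2 * p * ρ - ρ ^ 2} = chordParam C p '' Ioo 0 1 by
      rw [image_chordParam hC h]; rfl,
    lintegral_image_eq_lintegral_abs_deriv_mul measurableSet_Ioo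
      (fun m hm => (hasDerivAt_chordParam hC h hm.1).hasDerivWithinAt) (injOn_chordParam hC h)]
  refine setLIntegral_congr_fun measurableSet_Ioo fun m hm => ?_
  have hq := chord_factor_pos hC h hm.1
  have hS := sqrt_pos.2 (chord_radicand_pos hC h hm.1)
  have hm0 : 0 < m := hm.1
  have hm1 : 0 < 1 - m ^ 2 := by nlinarith [hm.2]
  simp only [rayDensity]
  rw [chord_quadratic hC, max_eq_left (by positivity), abs_of_pos (by positivity),
    ← ENNReal.ofReal_mul (by positivity), ← ENNReal.ofReal_mul (by positivity), chordParam]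
  congr 1
  set q := p * m + √(C + p ^ 2 * m ^ 2) with hqdef
  have e1 : 1 + p * m / √(C + p ^ 2 * m ^ 2) = q / √(C + p ^ 2 * m ^ 2) := by
    rw [hqdef]; field_simp; ring
  rw [e1, mul_rpow hm0.le hq.le, mul_rpow (by positivity) hm1.le, ← rpow_natCast q 2,
    ← rpow_mul hq.le]
  have e2 : q ^ ((2 : ℕ) : ℝ) * (q ^ (2 * β - 1) * q ^ (((2 : ℕ) : ℝ) * -β)) = q := by
    rw [← rpow_add hq, ← rpow_add hq]
    convert rpow_one q using 2
    push_cast; ring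
  calc _ = (q ^ ((2 : ℕ) : ℝ) * (q ^ (2 * β - 1) * q ^ (((2 : ℕ) : ℝ) * -β))) *
      (m ^ (2 * β - 1) * (1 - m ^ 2) ^ (-β)) / √(C + p ^ 2 * m ^ 2) := by ring
    _ = _ := by rw [e2]; ring

/-- The two half-chord integrals through a point of the ball add up to a constant. -/
lemma lintegral_rayDensity_add {β C p : ℝ} (hβ : 0 < β) (hβ1 : β < 1) (hC : 0 ≤ C)
    (h : 0 < C ∨ p ≠ 0) :
    (∫⁻ ρ in Ioi 0, rayDensity β C p ρ) + ∫⁻ ρ in Ioi 0, rayDensity β C (-p) ρ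
      = ENNReal.ofReal (beta β (1 - β)) := by
  have hbeta := lintegral_rpow_mul_one_sub_sq_rpow hβ (sub_pos.2 hβ1)
  rw [show 1 - β - 1 = -β by ring, ← lintegral_const_mul' _ _ (by simp)] at hbeta
  rw [← hbeta]
  -- At a boundary point C = 0, one ray leaves the ball at once and contributes 0; on the other the
  -- factor 1 + pm/√(p²m²) equals 2.
  rcases hC.eq_or_lt with rfl | hC0
  · have hp : p ≠ 0 := h.resolve_left (lt_irrefl _)
    wlog hp0 : 0 < p generalizing p
    · have := this (p := -p) (Or.inr (neg_ne_zero.2 hp)) (neg_ne_zero.2 hp)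
        (neg_pos.2 (lt_of_le_of_ne (not_lt.1 hp0) hp))
      rw [neg_neg, add_comm] at this
      exact this
    rw [lintegral_rayDensity hβ le_rfl (Or.inr hp0),
      setLIntegral_congr_fun (g := fun _ => 0) measurableSet_Ioi fun ρ (hρ : 0 < ρ) =>
        rayDensity_eq_zero hβ (by nlinarith [mul_pos hp0 hρ]), lintegral_zero, add_zero]
    refine setLIntegral_congr_fun measurableSet_Ioo fun m hm => ?_
    have hm0 : 0 < m := hm.1
    rw [zero_add, ← mul_pow, sqrt_sq (by positivity), div_self (by positivity), mul_comm]
    norm_num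
  · rw [lintegral_rayDensity hβ hC (Or.inl hC0), lintegral_rayDensity hβ hC (Or.inl hC0),
      ← lintegral_add_left (by fun_prop)]
    refine setLIntegral_congr_fun measurableSet_Ioo fun m hm => ?_
    have hS := sqrt_pos.2 (chord_radicand_pos (p := p) hC (Or.inl hC0) hm.1)
    have habs : |p * m / √(C + p ^ 2 * m ^ 2)| ≤ 1 := by
      rw [abs_div, abs_of_pos hS, div_le_one hS]
      exact abs_le_sqrt (by nlinarith)
    obtain ⟨h1, h2⟩ := abs_le.1 habs
    rw [neg_sq, ← mul_add, ← ENNReal.ofReal_add (by linarith) (by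
      rw [neg_mul, neg_div]; linarith), neg_mul, neg_div, mul_comm]
    congr 1
    ring_nf
    simp

end Chord

/-! ### Polar coordinates and the constant potential of the ball density -/

section Polar

variable {n : ℕ}

lemma lintegral_eq_lintegral_sphere [NeZero n] {G : EuclideanSpace ℝ (Fin n) → ENNReal}
    (hG : Measurable G) :
    ∫⁻ y, G y = ∫⁻ θ, ∫⁻ r in Ioi (0 : ℝ), ENNReal.ofReal (r ^ (n - 1)) *
      G (r • (θ : EuclideanSpace ℝ (Fin n))) ∂volume ∂(surfaceMeasure n) := by
  have hemb := (Homeomorph.measurableEmbedding (homeomorphUnitSphereProd (EuclideanSpace ℝ (Fin n))))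
  have hmp := (volume : Measure (EuclideanSpace ℝ (Fin n))).measurePreserving_homeomorphUnitSphereProd
  rw [finrank_euclideanSpace, Fintype.card_fin] at hmp
  have hGm : Measurable fun p : Metric.sphere (0 : EuclideanSpace ℝ (Fin n)) 1 × Ioi (0 : ℝ) =>
      G (p.2.1 • (p.1 : EuclideanSpace ℝ (Fin n))) := by fun_prop
  calc ∫⁻ y, G y = ∫⁻ y in {0}ᶜ, G y := by rw [restrict_compl_singleton]
    _ = ∫⁻ y : ({0}ᶜ : Set (EuclideanSpace ℝ (Fin n))), G y ∂(volume.comap Subtype.val) :=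
      (lintegral_subtype_comap (measurableSet_singleton _).compl G).symm
    _ = ∫⁻ p, G (p.2.1 • (p.1 : EuclideanSpace ℝ (Fin n)))
          ∂((surfaceMeasure n).prod (Measure.volumeIoiPow (n - 1))) := by
      rw [surfaceMeasure, ← hmp.lintegral_comp_emb hemb]
      refine lintegral_congr fun y => ?_
      congr 1
      exact congrArg Subtype.val
        ((homeomorphUnitSphereProd (EuclideanSpace ℝ (Fin n))).symm_apply_apply y).symm
    _ = _ := by
      rw [lintegral_prod _ hGm.aemeasurable]
      refine lintegral_congr fun θ => ?_
      rw [Measure.volumeIoiPow, lintegral_withDensity_eq_lintegral_mul _ (by fun_prop)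
        (by fun_prop)]
      exact lintegral_subtype_comap measurableSet_Ioi
        fun r => ENNReal.ofReal (r ^ (n - 1)) * G (r • (θ : EuclideanSpace ℝ (Fin n)))

lemma surfaceMeasure_orthogonal_eq_zero {x : EuclideanSpace ℝ (Fin n)} (hx : x ≠ 0) :
    ∀ᵐ θ : Metric.sphere (0 : EuclideanSpace ℝ (Fin n)) 1 ∂(surfaceMeasure n),
      inner ℝ x (θ : EuclideanSpace ℝ (Fin n)) ≠ 0 := by
  have hms : MeasurableSet {θ : Metric.sphere (0 : EuclideanSpace ℝ (Fin n)) 1 |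
      inner ℝ x (θ : EuclideanSpace ℝ (Fin n)) = 0} :=
    measurableSet_eq_fun (by fun_prop) measurable_const
  rw [ae_iff]
  simp only [ne_eq, not_not]
  -- Surface measure is a multiple of the volume of the cone over the set; here the cone lies in the
  -- proper subspace orthogonal to x.
  rw [surfaceMeasure, Measure.toSphere_apply' _ hms, mul_eq_zero]
  right
  refine measure_mono_null (t := ((ℝ ∙ x)ᗮ : Submodule ℝ (EuclideanSpace ℝ (Fin n)))) ?_
    (Measure.addHaar_submodule _ _ ?_)
  · rintro _ ⟨r, -, _, ⟨θ, hθ, rfl⟩, rfl⟩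
    rw [SetLike.mem_coe, Submodule.mem_orthogonal_singleton_iff_inner_right]
    simp only [inner_smul_right]
    rw [hθ, mul_zero]
  · intro h
    have : x ∈ (ℝ ∙ x)ᗮ := h ▸ Submodule.mem_top
    rw [Submodule.mem_orthogonal_singleton_iff_inner_right] at this
    exact hx (inner_self_eq_zero.1 this)

/-- The unnormalised equilibrium density `(R² - |y|²)₊ ^ (-β)` of the ball of radius `R`. -/
noncomputable def ballDensity (n : ℕ) (β R : ℝ) (y : EuclideanSpace ℝ (Fin n)) : ENNReal :=
  ENNReal.ofReal (max (R ^ 2 - ‖y‖ ^ 2) 0 ^ (-β))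

lemma measurable_ballDensity (β R : ℝ) : Measurable (ballDensity n β R) := by
  unfold ballDensity
  fun_prop

/-- The Jacobian and the kernel combine to r^(n-1-s) = r^(2β-1), which is where s = n - 2β enters.
-/
lemma rayDensity_eq_kernel_mul_ballDensity [NeZero n] {s β R r : ℝ} (hs : s = n - 2 * β)
    (hr : 0 < r) (x θ : EuclideanSpace ℝ (Fin n)) (hθ : ‖θ‖ = 1) :
    ENNReal.ofReal (r ^ (n - 1)) *
        (ENNReal.ofReal (‖r • θ‖ ^ (-s)) * ballDensity n β R (x + r • θ))
      = rayDensity β (R ^ 2 - ‖x‖ ^ 2) (-inner ℝ x θ) r := by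
  have hn : 1 ≤ n := NeZero.one_le
  rw [ballDensity, rayDensity, norm_add_sq_real, norm_smul, hθ, mul_one, inner_smul_right,
    norm_of_nonneg hr.le, ← ENNReal.ofReal_mul (by positivity), ← ENNReal.ofReal_mul (by positivity),
    ← mul_assoc, ← rpow_natCast, ← rpow_add hr, Nat.cast_sub hn, hs]
  congr 2
  · congr 1; push_cast; ring
  · congr 2; ring

/-- The Riesz potential of the density `(R² - |y|²) ^ (-β)` is constant on the closed ball. -/
lemma two_mul_lintegral_kernel_mul_ballDensity [NeZero n] {s β R : ℝ} (hs : s = n - 2 * β)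
    (hβ : 0 < β) (hβ1 : β < 1) (hR : 0 < R) {x : EuclideanSpace ℝ (Fin n)} (hx : ‖x‖ ≤ R) :
    2 * ∫⁻ y, rieszKernel s x y * ballDensity n β R y
      = ENNReal.ofReal (ProbabilityTheory.beta β (1 - β)) * surfaceMeasure n univ := by
  set H : EuclideanSpace ℝ (Fin n) → ENNReal :=
    fun z => ENNReal.ofReal (‖z‖ ^ (-s)) * ballDensity n β R (x + z) with hH
  have hHm : Measurable H := by
    have := measurable_ballDensity (n := n) β R
    fun_prop
  have h1 : ∫⁻ y, rieszKernel s x y * ballDensity n β R y = ∫⁻ z, H z := by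
    rw [← lintegral_add_left_eq_self _ x]
    refine lintegral_congr_ae ?_
    have : ∀ᵐ z : EuclideanSpace ℝ (Fin n), z ≠ 0 := by simp [ae_iff]
    filter_upwards [this] with z hz
    rw [rieszKernel_of_ne (by simpa using hz)]
    simp [hH]
  -- Symmetrising in z pairs each ray from x with the opposite one.
  have h2 : 2 * ∫⁻ z, H z = ∫⁻ z, (H z + H (-z)) := by
    rw [lintegral_add_left hHm, lintegral_neg_eq_self H, two_mul]
  have hC : 0 ≤ R ^ 2 - ‖x‖ ^ 2 := by nlinarith [norm_nonneg x]
  have hne : ∀ᵐ θ : Metric.sphere (0 : EuclideanSpace ℝ (Fin n)) 1 ∂(surfaceMeasure n),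
      0 < R ^ 2 - ‖x‖ ^ 2 ∨ -inner ℝ x (θ : EuclideanSpace ℝ (Fin n)) ≠ 0 := by
    -- For x on the sphere the tangent directions have C = p = 0 and must be discarded; they form a
    -- null set.
    rcases hC.eq_or_lt with h0 | h0
    · have hx0 : x ≠ 0 := by
        rintro rfl
        simp only [norm_zero] at h0
        nlinarith
      filter_upwards [surfaceMeasure_orthogonal_eq_zero hx0] with θ hθ
      exact Or.inr (neg_ne_zero.2 hθ)
    · exact ae_of_all _ fun θ => Or.inl h0
  rw [h1, h2, lintegral_eq_lintegral_sphere (G := fun z => H z + H (-z))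
      (hHm.fun_add (hHm.comp measurable_neg)),
    ← lintegral_const]
  refine lintegral_congr_ae ?_
  filter_upwards [hne] with θ hθ
  have hn1 : ‖(θ : EuclideanSpace ℝ (Fin n))‖ = 1 := by simp
  rw [← lintegral_rayDensity_add hβ hβ1 hC hθ, ← lintegral_add_left (measurable_rayDensity _ _ _)]
  refine setLIntegral_congr_fun measurableSet_Ioi fun r (hr : 0 < r) => ?_
  rw [mul_add, rayDensity_eq_kernel_mul_ballDensity hs hr x _ hn1, ← smul_neg,
    rayDensity_eq_kernel_mul_ballDensity hs hr x _ (by rwa [norm_neg]), inner_neg_right]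

end Polar

/-! ### The candidate measure on the disk: mass, support and potential -/

section Disk

variable {n : ℕ}

/-- The embedding `y ↦ (0, y)` of `ℝ^n` as a hyperplane of `ℝ^(n+1)`. -/
noncomputable def hyperplaneEmbed (n : ℕ) (y : EuclideanSpace ℝ (Fin n)) :
    EuclideanSpace ℝ (Fin (n + 1)) :=
  WithLp.toLp 2 (Matrix.vecCons 0 fun i => y i)

lemma continuous_hyperplaneEmbed : Continuous (hyperplaneEmbed n) := by
  refine (PiLp.continuous_toLp 2 _).comp (continuous_pi fun i => ?_)
  refine Fin.cases ?_ (fun j => ?_) i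
  · simpa using continuous_const
  · simp only [Matrix.cons_val_succ]
    fun_prop

lemma dist_hyperplaneEmbed (x y : EuclideanSpace ℝ (Fin n)) :
    dist (hyperplaneEmbed n x) (hyperplaneEmbed n y) = dist x y := by
  simp [EuclideanSpace.dist_eq, Fin.sum_univ_succ, hyperplaneEmbed]

lemma rieszKernel_hyperplaneEmbed (s : ℝ) (x y : EuclideanSpace ℝ (Fin n)) :
    rieszKernel s (hyperplaneEmbed n x) (hyperplaneEmbed n y) = rieszKernel s x y := by
  rw [rieszKernel, rieszKernel, edist_dist, edist_dist, dist_hyperplaneEmbed]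

lemma polarPoint_eq_hyperplaneEmbed (p : ℝ × Metric.sphere (0 : EuclideanSpace ℝ (Fin n)) 1) :
    polarPoint n p = hyperplaneEmbed n (p.1 • (p.2 : EuclideanSpace ℝ (Fin n))) := rfl

lemma mem_disk_iff {R : ℝ} (hR : 0 ≤ R) {x : EuclideanSpace ℝ (Fin (n + 1))} :
    x ∈ disk n R ↔ ∃ y, ‖y‖ ≤ R ∧ hyperplaneEmbed n y = x := by
  have hnorm : ∀ y : EuclideanSpace ℝ (Fin n), ‖y‖ ≤ R ↔ ∑ i, y i ^ 2 ≤ R ^ 2 := fun y => by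
    rw [← EuclideanSpace.real_norm_sq_eq, sq_le_sq₀ (norm_nonneg _) hR]
  constructor
  · rintro ⟨h0, h1⟩
    refine ⟨WithLp.toLp 2 fun i => x i.succ, (hnorm _).2 h1, ?_⟩
    ext i
    refine Fin.cases ?_ (fun j => ?_) i
    · simp [hyperplaneEmbed, h0]
    · simp [hyperplaneEmbed]
  · rintro ⟨y, hy, rfl⟩
    exact ⟨by simp [hyperplaneEmbed], by simpa [hyperplaneEmbed] using (hnorm y).1 hy⟩

lemma isClosed_disk (R : ℝ) : IsClosed (disk n R) := by
  have h0 : IsClosed {x : EuclideanSpace ℝ (Fin (n + 1)) | x 0 = 0} :=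
    isClosed_eq (by fun_prop) continuous_const
  have h1 : IsClosed {x : EuclideanSpace ℝ (Fin (n + 1)) | ∑ i : Fin n, x i.succ ^ 2 ≤ R ^ 2} :=
    isClosed_le (by fun_prop) continuous_const
  exact h0.inter h1

/-- Moves integrals to ℝ^n with Lebesgue measure, where polar coordinates may be recentred at any
point of the ball. -/
lemma lintegral_radialMeasure [NeZero n] {R A lam : ℝ} (hR : 0 ≤ R) (hA : 0 ≤ A) (hlam : lam < 1)
    {G : EuclideanSpace ℝ (Fin (n + 1)) → ENNReal} (hG : Measurable G) :
    ∫⁻ x, G x ∂(radialMeasure n R fun r => A * (R ^ 2 - r ^ 2) ^ (lam - 1))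
      = ENNReal.ofReal A * ∫⁻ y, G (hyperplaneEmbed n y) * ballDensity n (1 - lam) R y := by
  have hE : Measurable (hyperplaneEmbed n) := continuous_hyperplaneEmbed.measurable
  have hP : Measurable (polarPoint n) := by
    have : polarPoint n = fun p => hyperplaneEmbed n (p.1 • (p.2 : EuclideanSpace ℝ (Fin n))) :=
      funext polarPoint_eq_hyperplaneEmbed
    rw [this]
    fun_prop
  have hB := measurable_ballDensity (n := n) (1 - lam) R
  have : IsFiniteMeasure (surfaceMeasure n) := by unfold surfaceMeasure; infer_instance
  rw [radialMeasure, lintegral_map hG hP,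
    lintegral_prod_symm (fun p => G (polarPoint n p)) (by fun_prop),
    lintegral_eq_lintegral_sphere (by fun_prop), ← lintegral_const_mul' _ _ ENNReal.ofReal_ne_top]
  refine lintegral_congr fun θ => ?_
  have hθ : ‖(θ : EuclideanSpace ℝ (Fin n))‖ = 1 := by simp
  have hden : Measurable fun r : ℝ =>
      ENNReal.ofReal (A * (R ^ 2 - r ^ 2) ^ (lam - 1) * r ^ (n - 1)) := by fun_prop
  rw [lintegral_withDensity_eq_lintegral_mul _ hden (by fun_prop),
    ← lintegral_const_mul' _ _ ENNReal.ofReal_ne_top,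
    setLIntegral_congr (Ioc_ae_eq_Icc (a := (0 : ℝ)) (b := R)).symm,
    ← Ioi_inter_Iic, inter_comm, ← setLIntegral_indicator measurableSet_Iic]
  refine setLIntegral_congr_fun measurableSet_Ioi fun r (hr : 0 < r) => ?_
  have hnorm : ‖r • (θ : EuclideanSpace ℝ (Fin n))‖ = r := by
    rw [norm_smul, hθ, mul_one, norm_of_nonneg hr.le]
  by_cases hrR : r ≤ R
  · have h0 : 0 ≤ R ^ 2 - r ^ 2 := by nlinarith
    rw [indicator_of_mem (by exact hrR), Pi.mul_apply, polarPoint_eq_hyperplaneEmbed, ballDensity,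
      hnorm, max_eq_left h0, neg_sub, ENNReal.ofReal_mul (by positivity), ENNReal.ofReal_mul hA]
    ring
  · have h0 : R ^ 2 - r ^ 2 ≤ 0 := by nlinarith
    rw [indicator_of_notMem (by exact hrR), ballDensity, hnorm, max_eq_right h0,
      zero_rpow (by linarith)]
    simp

lemma lintegral_radial_ballDensity {a b R : ℝ} (ha : 0 < a) (hb : 0 < b) (hb1 : b < 1)
    (hR : 0 < R) :
    2 * ∫⁻ r in Ioi (0 : ℝ), ENNReal.ofReal (r ^ (2 * a - 1) * max (R ^ 2 - r ^ 2) 0 ^ (b - 1))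
      = ENNReal.ofReal (R ^ (2 * a + 2 * b - 2) * ProbabilityTheory.beta a b) := by
  have himg : (fun u : ℝ => R * u) '' Ioo 0 1 = Ioo 0 R := by
    rw [image_mul_left_Ioo hR, mul_zero, mul_one]
  have hsupp : ∀ r : ℝ, r ∈ Ioi 0 →
      ENNReal.ofReal (r ^ (2 * a - 1) * max (R ^ 2 - r ^ 2) 0 ^ (b - 1)) =
      (Iio R).indicator (fun r => ENNReal.ofReal
        (r ^ (2 * a - 1) * max (R ^ 2 - r ^ 2) 0 ^ (b - 1))) r := by
    intro r hr
    symm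
    rw [indicator_apply_eq_self]
    intro h
    rw [max_eq_right (by nlinarith [notMem_Iio.1 h, mem_Ioi.1 hr]), zero_rpow (by linarith)]
    simp
  rw [setLIntegral_congr_fun measurableSet_Ioi hsupp, setLIntegral_indicator measurableSet_Iio,
    inter_comm, Ioi_inter_Iio, ← himg,
    lintegral_image_eq_lintegral_abs_deriv_mul (f' := fun _ => R) measurableSet_Ioo
      (fun x _ => by simpa using ((hasDerivAt_id x).const_mul R).hasDerivWithinAt)
      (fun x _ y _ h => mul_left_cancel₀ hR.ne' h),
    ENNReal.ofReal_mul (by positivity), ← lintegral_rpow_mul_one_sub_sq_rpow ha hb,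
    mul_left_comm, ← lintegral_const_mul' _ _ ENNReal.ofReal_ne_top]
  congr 1
  refine setLIntegral_congr_fun measurableSet_Ioo fun u hu => ?_
  have hu0 : 0 < u := hu.1
  have hu1 : 0 < 1 - u ^ 2 := by nlinarith [hu.2]
  have e : R ^ 2 - (R * u) ^ 2 = R ^ (2 : ℝ) * (1 - u ^ 2) := by
    rw [Real.rpow_two]; ring
  rw [e, max_eq_left (by positivity), abs_of_pos hR, ← ENNReal.ofReal_mul hR.le,
    ← ENNReal.ofReal_mul (by positivity), mul_rpow hR.le hu0.le,
    mul_rpow (by positivity) hu1.le, ← rpow_mul hR.le]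
  congr 1
  have e2 : R ^ (2 * a + 2 * b - 2) = R * (R ^ (2 * a - 1) * R ^ (2 * (b - 1))) := by
    nth_rw 2 [← rpow_one R]
    rw [← rpow_add hR, ← rpow_add hR]
    congr 1
    ring
  rw [e2]
  ring

/-- This total mass dictates the choice of `equilibriumConst`. -/
lemma two_mul_lintegral_ballDensity [NeZero n] {lam R : ℝ} (h0 : 0 < lam) (h1 : lam < 1)
    (hR : 0 < R) :
    2 * ∫⁻ y, ballDensity n (1 - lam) R y
      = ENNReal.ofReal (R ^ (n + 2 * lam - 2) * ProbabilityTheory.beta (n / 2) lam) *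
        surfaceMeasure n univ := by
  have hn : 1 ≤ n := NeZero.one_le
  have hn' : (0 : ℝ) < n := by exact_mod_cast hn
  rw [lintegral_eq_lintegral_sphere (measurable_ballDensity _ _),
    ← lintegral_const_mul' _ _ (by simp), ← lintegral_const]
  refine lintegral_congr fun θ => ?_
  have hθ : ‖(θ : EuclideanSpace ℝ (Fin n))‖ = 1 := by simp
  rw [show (n : ℝ) + 2 * lam - 2 = 2 * (n / 2) + 2 * lam - 2 by ring,
    ← lintegral_radial_ballDensity (by positivity) h0 h1 hR]
  congr 1
  refine setLIntegral_congr_fun measurableSet_Ioi fun r (hr : 0 < r) => ?_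
  rw [ballDensity, norm_smul, hθ, mul_one, norm_of_nonneg hr.le,
    ← ENNReal.ofReal_mul (by positivity), ← rpow_natCast r (n - 1), Nat.cast_sub hn]
  congr 3
  · push_cast; ring
  · ring

lemma surfaceMeasure_univ [NeZero n] :
    surfaceMeasure n univ = ENNReal.ofReal (2 * π ^ ((n : ℝ) / 2) / Gamma (n / 2)) := by
  have hn : (0 : ℝ) < n := by exact_mod_cast NeZero.pos n
  rw [surfaceMeasure, Measure.toSphere_apply_univ, finrank_euclideanSpace,
    EuclideanSpace.volume_ball, Fintype.card_fin, ENNReal.ofReal_one, one_pow, one_mul,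
    ← ENNReal.ofReal_natCast, ← ENNReal.ofReal_mul (by positivity),
    Gamma_add_one (by positivity), sqrt_eq_rpow, ← rpow_natCast, ← rpow_mul pi_pos.le]
  congr 1
  rw [show 1 / 2 * (n : ℝ) = n / 2 by ring]
  field_simp

/-- The normalising constant of the equilibrium density. -/
noncomputable def equilibriumConst (n : ℕ) (lam R : ℝ) : ℝ :=
  Gamma (n / 2 + lam) / (π ^ ((n : ℝ) / 2) * Gamma lam) * (1 / R ^ (n + 2 * lam - 2))

lemma equilibriumConst_pos [NeZero n] {lam R : ℝ} (h0 : 0 < lam) (hR : 0 < R) :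
    0 < equilibriumConst n lam R := by
  have hn : (0 : ℝ) < n := by exact_mod_cast NeZero.pos n
  have := Gamma_pos_of_pos h0
  have := Gamma_pos_of_pos (show 0 < n / 2 + lam by positivity)
  unfold equilibriumConst
  positivity

/-- The minimal energy of the disk. -/
noncomputable def diskEnergy (n : ℕ) (lam R : ℝ) : ℝ :=
  π / sin (π * lam) * Gamma (n / 2 + lam) / (Gamma lam * Gamma (n / 2) * R ^ (n + 2 * lam - 2))

/-- The equilibrium measure of the disk. -/
noncomputable def equilibriumMeasure (n : ℕ) (lam R : ℝ) :
    Measure (EuclideanSpace ℝ (Fin (n + 1))) :=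
  radialMeasure n R fun r => equilibriumConst n lam R * (R ^ 2 - r ^ 2) ^ (lam - 1)

lemma isProbabilityMeasure_equilibriumMeasure [NeZero n] {lam R : ℝ} (h0 : 0 < lam)
    (h1 : lam < 1) (hR : 0 < R) : IsProbabilityMeasure (equilibriumMeasure n lam R) := by
  have hn : (0 : ℝ) < n := by exact_mod_cast NeZero.pos n
  have hg0 := Gamma_pos_of_pos h0
  have hg1 := Gamma_pos_of_pos (show 0 < n / 2 + lam by positivity)
  have hg2 := Gamma_pos_of_pos (show 0 < (n : ℝ) / 2 by positivity)
  have hA := equilibriumConst_pos (n := n) h0 hR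
  constructor
  rw [← lintegral_one, equilibriumMeasure,
    lintegral_radialMeasure hR.le hA.le h1 measurable_const]
  simp only [one_mul]
  rw [← ENNReal.mul_right_inj two_ne_zero ENNReal.ofNat_ne_top, mul_left_comm,
    two_mul_lintegral_ballDensity h0 h1 hR, surfaceMeasure_univ,
    ← ENNReal.ofReal_mul (by
      have := ProbabilityTheory.beta_pos (show 0 < (n : ℝ) / 2 by positivity) h0
      positivity),
    ← ENNReal.ofReal_mul hA.le, mul_one,
    ← ENNReal.ofReal_ofNat]
  congr 1
  unfold equilibriumConst ProbabilityTheory.beta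
  field_simp

lemma lintegral_kernel_equilibriumMeasure [NeZero n] {lam s R : ℝ} (h0 : 0 < lam)
    (h1 : lam < 1) (hR : 0 < R) (hs : s = n - 2 + 2 * lam)
    {x : EuclideanSpace ℝ (Fin (n + 1))} (hx : x ∈ disk n R) :
    ∫⁻ y, rieszKernel s x y ∂(equilibriumMeasure n lam R) = ENNReal.ofReal (diskEnergy n lam R) := by
  have hn : (0 : ℝ) < n := by exact_mod_cast NeZero.pos n
  have hg0 := Gamma_pos_of_pos h0
  have hg1 := Gamma_pos_of_pos (show 0 < n / 2 + lam by positivity)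
  have hg2 := Gamma_pos_of_pos (show 0 < (n : ℝ) / 2 by positivity)
  have hA := equilibriumConst_pos (n := n) h0 hR
  have hb := ProbabilityTheory.beta_pos (sub_pos.2 h1) h0
  obtain ⟨x, hxR, rfl⟩ := (mem_disk_iff hR.le).1 hx
  rw [equilibriumMeasure, lintegral_radialMeasure hR.le hA.le h1
    (by unfold rieszKernel; fun_prop)]
  simp only [rieszKernel_hyperplaneEmbed]
  have key := two_mul_lintegral_kernel_mul_ballDensity (n := n) (s := s) (β := 1 - lam)
    (by rw [hs]; ring) (by linarith) (by linarith) hR hxR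
  rw [sub_sub_cancel] at key
  rw [← ENNReal.mul_right_inj two_ne_zero ENNReal.ofNat_ne_top, mul_left_comm, key,
    surfaceMeasure_univ, ← ENNReal.ofReal_mul hb.le, ← ENNReal.ofReal_mul hA.le,
    ← ENNReal.ofReal_ofNat, ← ENNReal.ofReal_mul (by norm_num)]
  congr 1
  unfold equilibriumConst ProbabilityTheory.beta diskEnergy
  -- By the reflection formula B(1 - λ, λ) = Γ(λ) Γ(1 - λ) = π / sin(πλ).
  rw [sub_add_cancel, Gamma_one, ← Gamma_mul_Gamma_one_sub]
  field_simp

lemma equilibriumMeasure_compl_disk [NeZero n] {lam R : ℝ} (h0 : 0 < lam)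
    (h1 : lam < 1) (hR : 0 < R) : equilibriumMeasure n lam R (disk n R)ᶜ = 0 := by
  have hm : MeasurableSet (disk n R)ᶜ := (isClosed_disk R).measurableSet.compl
  rw [← lintegral_indicator_one hm, equilibriumMeasure,
    lintegral_radialMeasure hR.le (equilibriumConst_pos h0 hR).le h1
      (measurable_one.indicator hm), mul_eq_zero]
  right
  refine lintegral_eq_zero_of_ae_eq_zero (ae_of_all _ fun y => ?_)
  simp only [Pi.zero_apply, mul_eq_zero, or_iff_not_imp_left]
  intro h
  have hy : hyperplaneEmbed n y ∉ disk n R := (mem_of_indicator_ne_zero h)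
  have hy2 : R < ‖y‖ := not_le.1 fun hle => hy ((mem_disk_iff hR.le).2 ⟨y, hle, rfl⟩)
  rw [ballDensity, max_eq_right (by nlinarith), zero_rpow (by linarith)]
  simp

end Disk

/-! ### Constant potential characterises the equilibrium measure -/

section Equilibrium

variable {m : ℕ}

/-- A unit measure with constant finite potential on `E` is the only equilibrium measure of `E`. -/
lemma isEquilibriumMeasure_iff_of_potential_const {s : ℝ} (hs : 0 < s)
    {E : Set (EuclideanSpace ℝ (Fin m))} {ν : Measure (EuclideanSpace ℝ (Fin m))}
    (hν : ν ∈ unitMeasures E) {W : ENNReal} (hW : W ≠ ⊤)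
    (hpot : ∀ x ∈ E, ∫⁻ y, rieszKernel s x y ∂ν = W) :
    minEnergy s E = W ∧ ∀ μ, IsEquilibriumMeasure s E μ ↔ μ = ν := by
  have hmut : ∀ μ ∈ unitMeasures E, mutualEnergy s μ ν = W := by
    intro μ hμ
    have := hμ.1
    have hE : ∀ᵐ x ∂μ, x ∈ E := hμ.2
    rw [mutualEnergy, lintegral_congr_ae (g := fun _ => W) (hE.mono hpot), lintegral_const,
      measure_univ, mul_one]
  have hνW : rieszEnergy s ν = W := hmut ν hν
  have hmin : minEnergy s E = W := by
    refine le_antisymm ((iInf₂_le ν hν).trans hνW.le) (le_iInf₂ fun μ hμ => ?_)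
    have := hμ.1
    have := hν.1
    -- Here 2W ≤ I(μ) + W, and the finite W cancels.
    have h := two_mul_mutualEnergy_le hs μ ν
    rw [hmut μ hμ, hmut ν hν, two_mul] at h
    exact (ENNReal.add_le_add_iff_right hW).1 h
  refine ⟨hmin, fun μ => ⟨fun hμ => ?_, ?_⟩⟩
  · have := hμ.1.1
    have := hν.1
    have hμW : mutualEnergy s μ μ = W := hμ.2.trans hmin
    -- For a minimiser all three energies equal W: the equality case of positive definiteness.
    refine eq_of_mutualEnergy_le hs μ ν ?_ ?_
    · rw [hμW, hmut ν hν]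
      exact ENNReal.add_ne_top.2 ⟨hW, hW⟩
    · rw [hμW, hmut ν hν, hmut μ hμ.1, two_mul]
  · rintro rfl
    exact ⟨hν, hνW.trans hmin.symm⟩

end Equilibrium

end RieszDisk

/-! ### Equilibrium measure and capacity of the disk in the parameter d = n + 1 -/

open RieszDisk in
theorem theorem3 (d n : ℕ) (hd : 3 ≤ d) (hn : d = n + 1) (lam s R : ℝ)
    (hlam0 : 0 < lam) (hlam1 : lam < 1) (hs : s = ((d : ℝ) - 3) + 2 * lam) (hR : 0 < R) :
    (∀ μ : Measure (EuclideanSpace ℝ (Fin (n + 1))),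
      RieszDisk.IsEquilibriumMeasure s (RieszDisk.disk n R) μ ↔
        μ = RieszDisk.radialMeasure n R fun r =>
          Real.Gamma (((d : ℝ) + 2 * lam - 1) / 2) /
              (Real.pi ^ (((d : ℝ) - 1) / 2) * Real.Gamma lam) *
            (1 / R ^ ((d : ℝ) + 2 * lam - 3)) * (R ^ 2 - r ^ 2) ^ (lam - 1)) ∧
    RieszDisk.rieszCapacity s (RieszDisk.disk n R) =
      ENNReal.ofReal
        (Real.sin (lam * Real.pi) * Real.Gamma lam * Real.Gamma (((d : ℝ) - 1) / 2) /
            (Real.pi * Real.Gamma (((d : ℝ) + 2 * lam - 1) / 2)) *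
          R ^ ((d : ℝ) + 2 * lam - 3)) := by
  have : NeZero n := ⟨by omega⟩
  -- The bound n ≥ 2 makes s = n - 2 + 2λ positive, as positive definiteness requires.
  have hn2 : (2 : ℝ) ≤ n := by exact_mod_cast (show 2 ≤ n by omega)
  have hdn : (d : ℝ) = n + 1 := by rw [hn]; push_cast; ring
  have e1 : ((d : ℝ) + 2 * lam - 1) / 2 = n / 2 + lam := by rw [hdn]; ring
  have e2 : (d : ℝ) + 2 * lam - 3 = n + 2 * lam - 2 := by rw [hdn]; ring
  have e3 : ((d : ℝ) - 1) / 2 = n / 2 := by rw [hdn]; ring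
  have hs' : s = n - 2 + 2 * lam := by rw [hs, hdn]; ring
  rw [e1, e2, e3]
  obtain ⟨hmin, huniq⟩ := isEquilibriumMeasure_iff_of_potential_const (m := n + 1) (s := s)
    (by linarith) (E := disk n R) (ν := equilibriumMeasure n lam R)
    ⟨isProbabilityMeasure_equilibriumMeasure hlam0 hlam1 hR,
      equilibriumMeasure_compl_disk hlam0 hlam1 hR⟩ ENNReal.ofReal_ne_top
    fun x hx => lintegral_kernel_equilibriumMeasure hlam0 hlam1 hR hs' hx
  refine ⟨huniq, ?_⟩
  have hg0 := Real.Gamma_pos_of_pos hlam0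
  have hg1 := Real.Gamma_pos_of_pos (show 0 < n / 2 + lam by positivity)
  have hg2 := Real.Gamma_pos_of_pos (show 0 < (n : ℝ) / 2 by positivity)
  have hsin : 0 < Real.sin (Real.pi * lam) :=
    Real.sin_pos_of_pos_of_lt_pi (by positivity) (by nlinarith [Real.pi_pos])
  rw [rieszCapacity, hmin, one_div, ← ENNReal.ofReal_inv_of_pos (by unfold diskEnergy; positivity)]
  congr 1
  unfold diskEnergy
  rw [mul_comm lam Real.pi]
  field_simp
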